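/- Let $d\ge 1$, let $\mathbb{B}_d$ be the open Euclidean unit ball of $\mathbb{R}^d$, and let $\mathrm{U}_d$ be the spherical uniform distribution, that is, the probability measure on $\mathbb{R}^d$ with density $u_d(x)=\frac{1}{a_d|x|^{d-1}}$ for $x\in\mathbb{B}_d\setminus\{0\}$ and $u_d(x)=0$ otherwise, where $a_d=2\pi^{d/2}/\Gamma(d/2)$. For a Borel probability measure $\mathrm{P}$ on $\mathbb{R}^d$ there is a unique convex function $\psi:\mathbb{B}_d\to\mathbb{R}$ with $\psi(0)=0$ whose (almost everywhere defined) gradient pushes $\mathrm{U}_d$ forward to $\mathrm{P}$. Put $$\varphi(x)=\sup_{|u|<1}\big(\langle x,u\rangle-\psi(u)\big),\qquad x\in\mathbb{R}^d .$$ The center-outward distribution function of $\mathrm{P}$ is the (possibly multivalued) map $\mathbf{F}_\pm=\partial\varphi$, where $\partial\varphi(x)=\{y\in\mathbb{R}^d:\varphi(z)\ge\varphi(x)+\langle y,z-x\rangle\text{ for all }z\in\mathbb{R}^d\}$; it is called continuous if it is single-valued at every point of $\mathbb{R}^d$ and continuous as a map $\mathbb{R}^d\to\mathbb{R}^d$.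 **Theorem.** Let $\mu_m$ ($m\in\mathbb{N}$) and $\mathrm{P}$ be Borel probability measures on $\mathbb{R}^d$ such that every $\mu_m$ has a continuous center-outward distribution function $\mathbf{F}^m_\pm$ and $\mathrm{P}$ has a continuous center-outward distribution function $\mathbf{F}_\pm$. If $\mu_m$ converges weakly to $\mathrm{P}$, then $$\sup_{x\in\mathbb{R}^d}\big|\mathbf{F}^m_\pm(x)-\mathbf{F}_\pm(x)\big|\longrightarrow 0\qquad (m\to\infty).$$ -/

import Mathlib

open MeasureTheory Filter Topology

namespace CenterOutward

/-- The spherical uniform distribution `U_d` over the open unit ball of `ℝ^d` (`d ≥ 1`): the measure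
with density `x ↦ 1 / (a_d |x|^(d-1))` on the punctured open unit ball and `0` elsewhere, where
`a_d = 2 π^(d/2) / Γ(d/2)`. -/
noncomputable def sphericalUniform (d : ℕ) : Measure (EuclideanSpace ℝ (Fin d)) :=
  volume.withDensity fun x =>
    ENNReal.ofReal
      ((Metric.ball (0 : EuclideanSpace ℝ (Fin d)) 1 \ {0}).indicator
        (fun y => 1 / (2 * Real.pi ^ ((d : ℝ) / 2) / Real.Gamma ((d : ℝ) / 2) * ‖y‖ ^ (d - 1))) x)

/-- `ψ` is a center-outward quantile potential of `P`: it is finite and convex on the open unit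
ball, normalized by `ψ 0 = 0`, and its gradient (the center-outward quantile map of `P`) pushes
`U_d` forward to `P`. The gradient exists almost everywhere in the ball, and it is a measurable
function; the values of `ψ` outside the open ball play no role. -/
structure IsQuantilePotential {d : ℕ} (P : Measure (EuclideanSpace ℝ (Fin d)))
    (ψ : EuclideanSpace ℝ (Fin d) → ℝ) : Prop where
  convexOn : ConvexOn ℝ (Metric.ball 0 1) ψ
  map_zero : ψ 0 = 0
  map_gradient : (sphericalUniform d).map (gradient ψ) = P

/-- The function `φ(x) = sup_{|u| < 1} (⟨x, u⟩ - ψ(u))`. For `ψ` convex on the open unit ball the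
supremum is finite, because `ψ` has an affine minorant there. It is the Legendre transform of `ψ`
extended to the unit sphere by lower limits and by `+∞` outside the closed ball. -/
noncomputable def conjugate {d : ℕ} (ψ : EuclideanSpace ℝ (Fin d) → ℝ)
    (x : EuclideanSpace ℝ (Fin d)) : ℝ :=
  ⨆ u : Metric.ball (0 : EuclideanSpace ℝ (Fin d)) 1,
    (inner ℝ x (u : EuclideanSpace ℝ (Fin d)) - ψ u)

/-- The subdifferential `∂f(x)`: all `y` with `f(z) ≥ f(x) + ⟨y, z - x⟩` for every `z`. -/
def subdifferential {d : ℕ} (f : EuclideanSpace ℝ (Fin d) → ℝ)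
    (x : EuclideanSpace ℝ (Fin d)) : Set (EuclideanSpace ℝ (Fin d)) :=
  {y | ∀ z, f x + inner ℝ y (z - x) ≤ f z}

/-- `P` has a continuous center-outward distribution function, and it is `F`: for a quantile
potential `ψ` of `P` with conjugate `φ`, the (a priori multivalued) center-outward map `∂φ` is
single-valued at every point of `ℝ^d`, with value `F x` at `x`, and `F` is continuous. -/
def IsContinuousDistributionFunction {d : ℕ} (P : Measure (EuclideanSpace ℝ (Fin d)))
    (F : EuclideanSpace ℝ (Fin d) → EuclideanSpace ℝ (Fin d)) : Prop :=
  (∃ ψ, IsQuantilePotential P ψ ∧ ∀ x, subdifferential (conjugate ψ) x = {F x}) ∧ Continuous F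

end CenterOutward

/-!
The proof follows the convex potentials `Ψ m` of the measures `μ m` rather than couplings.

*Compactness.* A large subgradient of `Ψ m` at a point well inside the unit ball forces, by
monotonicity, the gradient to be large on a ball of fixed radius, hence with `U_d`-probability
bounded away from zero. Tightness of `μ m` excludes this
(`locallyBoundedSubgradients_of_tendsto`), so the potentials are equi-Lipschitz on smaller balls and
have pointwise convergent subsequences. Their gradients converge almost everywhere, so every limit
`χ` is a quantile potential of `P` (`IsQuantilePotential.of_tendsto`).

*Uniqueness* (`IsQuantilePotential.eqOn_ball`). Let `ψ` be the potential with conjugate `φ` and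
`∂φ = {F}`. The map `T = F ∘ ∇χ` preserves `U_d`, and adding the subgradient inequalities of `ψ` at
`T u` and of `χ` at `u`, both with slope `∇χ u`, gives `(ψ - χ) (T u) ≤ (ψ - χ) u`. A function that
does not increase along a map preserving a finite measure is almost everywhere invariant, and
equality makes `∇χ u` a subgradient of `ψ` at `u`. Hence `ψ` and `χ` have a common subgradient at
every point of the ball, so they differ by a constant. Thus `Ψ m → ψ` pointwise on the ball.

*Conjugates.* Then the conjugates `φ_m` converge pointwise to `φ`. They are `1`-Lipschitz, so a
limit point of `Fm m (x_m)`, where `x_m → x`, is a subgradient of `φ` at `x`, that is, `F x`. This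
gives uniform convergence on compact sets. Far from the origin all of the maps are uniformly close
to `x ↦ x / ‖x‖` (`LocallyBoundedSubgradients.eventually_norm_sub_direction_le`).
-/

namespace CenterOutward

/-! ### Subgradients of convex functions -/

section Convex

variable {E : Type*} [NormedAddCommGroup E] [InnerProductSpace ℝ E]

/-- The subdifferential of `ψ` at `u` relative to the set `s`: the subgradient inequality is only
asked at the points of `s`, the values of `ψ` elsewhere being irrelevant. -/
def subgradientsOn (s : Set E) (ψ : E → ℝ) (u : E) : Set E :=
  {p | ∀ v ∈ s, ψ u + inner ℝ p (v - u) ≤ ψ v}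

variable {s : Set E} {ψ χ : E → ℝ} {u p : E}

/-- Separate the point `(u, ψ u)` from the strict epigraph of `ψ`. -/
theorem exists_mem_subgradientsOn [FiniteDimensional ℝ E] (hs : IsOpen s) (hψ : ConvexOn ℝ s ψ)
    (hu : u ∈ s) : ∃ p, p ∈ subgradientsOn s ψ u := by
  have hopen : IsOpen {a : E × ℝ | a.1 ∈ s ∧ ψ a.1 < a.2} := by
    have hc : ContinuousOn (fun a : E × ℝ => a.2 - ψ a.1) (s ×ˢ Set.univ) :=
      continuous_snd.continuousOn.sub
        ((hψ.continuousOn hs).comp continuous_fst.continuousOn fun a ha => ha.1)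
    have h := hc.isOpen_inter_preimage (hs.prod isOpen_univ) (isOpen_Ioi (a := (0 : ℝ)))
    convert h using 1
    ext a
    simp
  obtain ⟨f, hf⟩ := geometric_hahn_banach_open_point hψ.convex_strict_epigraph hopen
    (x := (u, ψ u)) (by simp)
  have hsplit : ∀ (x : E) (t : ℝ), f (x, t) = f (x, 0) + t * f (0, 1) := by
    intro x t
    have : ((x, t) : E × ℝ) = (x, 0) + t • (0, 1) := by simp
    rw [this, map_add, map_smul, smul_eq_mul]
  set c := f (0, 1) with hc
  have hc0 : c < 0 := by
    have h := hf (u, ψ u + 1) ⟨hu, by simp⟩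
    rw [hsplit u, hsplit u (ψ u)] at h
    linarith
  refine ⟨(InnerProductSpace.toDual ℝ E).symm
    ((-c)⁻¹ • f.comp (ContinuousLinearMap.inl ℝ E ℝ)), fun v hv => ?_⟩
  have key : f (v, 0) - f (u, 0) ≤ (ψ v - ψ u) * (-c) := by
    refine le_of_forall_pos_le_add fun ε hε => ?_
    have h := hf (v, ψ v + ε / (-c)) ⟨hv, by
      have : 0 < ε / (-c) := div_pos hε (by linarith)
      simpa using this⟩
    rw [hsplit v, hsplit u (ψ u)] at h
    have : ε / (-c) * c = -ε := by
      rw [div_neg, neg_mul, div_mul_cancel₀ _ hc0.ne]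
    nlinarith
  have hval : inner ℝ ((InnerProductSpace.toDual ℝ E).symm
      ((-c)⁻¹ • f.comp (ContinuousLinearMap.inl ℝ E ℝ))) (v - u)
      = (f (v, 0) - f (u, 0)) / (-c) := by
    rw [InnerProductSpace.toDual_symm_apply]
    have : f (v - u, 0) = f (v, 0) - f (u, 0) := by rw [← map_sub]; simp
    simp [this, div_eq_inv_mul]
  rw [hval]
  have := (div_le_iff₀ (by linarith : 0 < -c)).2 key
  linarith

theorem eq_gradient_of_mem_subgradientsOn [CompleteSpace E] (hs : s ∈ 𝓝 u)
    (hd : DifferentiableAt ℝ ψ u) (hp : p ∈ subgradientsOn s ψ u) : p = gradient ψ u := by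
  have hmin : IsLocalMin (fun v => ψ v - inner ℝ p v) u := by
    filter_upwards [hs] with v hv
    have := hp v hv
    rw [inner_sub_right] at this
    linarith
  have hder : HasFDerivAt (fun v => ψ v - inner ℝ p v) (fderiv ℝ ψ u - innerSL ℝ p) u :=
    hd.hasFDerivAt.sub (innerSL ℝ p).hasFDerivAt
  have h0 := hmin.hasFDerivAt_eq_zero hder
  refine ext_inner_right ℝ fun v => ?_
  have h1 : fderiv ℝ ψ u v = inner ℝ p v := by
    have := congrArg (fun L => L v) h0
    simpa [sub_eq_zero] using this
  rw [← h1, gradient, InnerProductSpace.toDual_symm_apply]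

theorem gradient_mem_subgradientsOn [FiniteDimensional ℝ E] (hs : IsOpen s)
    (hψ : ConvexOn ℝ s ψ) (hu : u ∈ s) (hd : DifferentiableAt ℝ ψ u) :
    gradient ψ u ∈ subgradientsOn s ψ u := by
  obtain ⟨p, hp⟩ := exists_mem_subgradientsOn hs hψ hu
  rwa [← eq_gradient_of_mem_subgradientsOn (hs.mem_nhds hu) hd hp]

theorem ae_differentiableAt_of_convexOn [FiniteDimensional ℝ E] [MeasurableSpace E]
    [BorelSpace E] (ν : Measure E) [ν.IsAddHaarMeasure] (hs : IsOpen s) (hψ : ConvexOn ℝ s ψ) :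
    ∀ᵐ u ∂ν, u ∈ s → DifferentiableAt ℝ ψ u := by
  rw [ae_iff]
  refine measure_null_of_locally_null _ fun x hx => ?_
  have hxs : x ∈ s := by
    by_contra h
    exact hx fun h' => absurd h' h
  obtain ⟨K, t, ht, hK⟩ := hψ.locallyLipschitzOn hs hxs
  rw [hs.nhdsWithin_eq hxs] at ht
  refine ⟨_, mem_nhdsWithin_of_mem_nhds (interior_mem_nhds.2 ht) |> fun h =>
    inter_mem h self_mem_nhdsWithin, ?_⟩
  refine measure_mono_null ?_ (ae_iff.1 (hK.ae_differentiableWithinAt_of_mem (μ := ν)))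
  rintro y ⟨hy, hyd⟩ h
  exact hyd fun _ => (h (interior_subset hy)).differentiableAt (mem_interior_iff_mem_nhds.1 hy)

/-- Move from `u` a little in the direction `p`. -/
theorem norm_le_of_mem_subgradientsOn {K : NNReal} {t : Set E} (hs : s ∈ 𝓝 u) (ht : t ∈ 𝓝 u)
    (hK : LipschitzOnWith K ψ t) (hp : p ∈ subgradientsOn s ψ u) : ‖p‖ ≤ K := by
  have hlim : Tendsto (fun r : ℝ => u + r • p) (𝓝[>] 0) (𝓝 u) := by
    have : Continuous fun r : ℝ => u + r • p := by fun_prop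
    simpa using (this.tendsto 0).mono_left nhdsWithin_le_nhds
  obtain ⟨r, ⟨hrs, hrt⟩, hr⟩ :=
    (((hlim.eventually hs).and (hlim.eventually ht)).and self_mem_nhdsWithin).exists
  have hr : 0 < r := hr
  have h1 := hp _ hrs
  have h2 := (le_abs_self _).trans (hK.dist_le_mul _ hrt _ (mem_of_mem_nhds ht))
  rw [add_sub_cancel_left, inner_smul_right, real_inner_self_eq_norm_sq] at h1
  rw [dist_eq_norm, add_sub_cancel_left, norm_smul, Real.norm_of_nonneg hr.le] at h2
  rcases (norm_nonneg p).eq_or_lt with h0 | h0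
  · rw [← h0]
    exact K.2
  · have h3 : (r * ‖p‖) * ‖p‖ ≤ (r * ‖p‖) * K := by nlinarith
    exact le_of_mul_le_mul_left h3 (by positivity)

theorem sub_le_of_subgradientsOn_norm_le {C : ℝ} {v : E}
    (hp : p ∈ subgradientsOn s ψ u) (hv : v ∈ s) (hC : ‖p‖ ≤ C) : ψ u - ψ v ≤ C * ‖u - v‖ := by
  have h1 := hp v hv
  have h2 : inner ℝ p (u - v) ≤ ‖p‖ * ‖u - v‖ := real_inner_le_norm _ _
  have h3 : inner ℝ p (v - u) = -inner ℝ p (u - v) := by rw [← inner_neg_right, neg_sub]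
  nlinarith [norm_nonneg (u - v)]

theorem mem_subgradientsOn_of_tendsto {ι : Type*} {l : Filter ι} [l.NeBot] {Ψ : ι → E → ℝ}
    {q w : ι → E} (hΨ : ∀ v ∈ s, Tendsto (fun i => Ψ i v) l (𝓝 (ψ v)))
    (hw : Tendsto w l (𝓝 u)) (hΨw : Tendsto (fun i => Ψ i (w i)) l (𝓝 (ψ u)))
    (hq : Tendsto q l (𝓝 p)) (hmem : ∀ᶠ i in l, q i ∈ subgradientsOn s (Ψ i) (w i)) :
    p ∈ subgradientsOn s ψ u := fun v hv =>
  le_of_tendsto_of_tendsto (hΨw.add (hq.inner (tendsto_const_nhds.sub hw))) (hΨ v hv)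
    (hmem.mono fun _ hi => hi v hv)

/-- Subdividing the segment from `u` to `v` into `N` pieces, the subgradient inequalities at the
nodes bound the difference by a telescoping sum that is `O(1 / N)`. -/
theorem sub_le_sub_of_common_subgradients (hs : Convex ℝ s)
    (h : ∀ w ∈ s, ∃ p, p ∈ subgradientsOn s ψ w ∧ p ∈ subgradientsOn s χ w) {v : E}
    (hu : u ∈ s) (hv : v ∈ s) : ψ v - χ v ≤ ψ u - χ u := by
  choose! P hPψ hPχ using h
  have key : ∀ N : ℕ, 0 < N →
      (ψ v - χ v) - (ψ u - χ u) ≤ inner ℝ (P v - P u) (v - u) / N := by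
    intro N hN
    have hN' : (0 : ℝ) < N := by exact_mod_cast hN
    set w : ℕ → E := fun i => u + ((i : ℝ) / N) • (v - u) with hw
    have hws : ∀ i ≤ N, w i ∈ s := fun i hi =>
      hs.add_smul_sub_mem hu hv ⟨by positivity, (div_le_one hN').2 (by exact_mod_cast hi)⟩
    have hstep : ∀ i, w (i + 1) - w i = (1 / N : ℝ) • (v - u) := by
      intro i
      simp only [hw, add_sub_add_left_eq_sub, ← sub_smul]
      congr 1
      push_cast
      ring
    have hdiff : ∀ i ∈ Finset.range N,
        (ψ (w (i + 1)) - χ (w (i + 1))) - (ψ (w i) - χ (w i))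
          ≤ inner ℝ (P (w (i + 1))) (v - u) / N - inner ℝ (P (w i)) (v - u) / N := by
      intro i hi
      have hi' := Finset.mem_range.1 hi
      have h1 := hPψ _ (hws _ hi') _ (hws _ hi'.le)
      have h2 := hPχ _ (hws _ hi'.le) _ (hws _ hi')
      rw [← neg_sub, inner_neg_right, hstep, inner_smul_right] at h1
      rw [hstep, inner_smul_right] at h2
      simp only [div_eq_inv_mul, mul_one] at h1 h2 ⊢
      linarith
    have hsum := Finset.sum_le_sum hdiff
    rw [Finset.sum_range_sub (fun i => ψ (w i) - χ (w i)),
      Finset.sum_range_sub (fun i => inner ℝ (P (w i)) (v - u) / (N : ℝ))] at hsum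
    have hw0 : w 0 = u := by simp [hw]
    have hwN : w N = v := by simp [hw, div_self hN'.ne']
    rw [hw0, hwN] at hsum
    rwa [inner_sub_left, sub_div]
  have hlim := tendsto_const_div_atTop_nhds_zero_nat (inner ℝ (P v - P u) (v - u))
  have := ge_of_tendsto hlim (eventually_atTop.2 ⟨1, fun N hN => key N hN⟩)
  linarith

/-- Common subgradients pass to limits: near `u` they are bounded by the Lipschitz constant of `ψ`. -/
theorem exists_common_subgradient_of_ae [FiniteDimensional ℝ E] [MeasurableSpace E] [BorelSpace E]
    (ν : Measure E) [ν.IsOpenPosMeasure] (hs : IsOpen s) (hψ : ConvexOn ℝ s ψ)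
    (hχ : ConvexOn ℝ s χ)
    (h : ∀ᵐ w ∂ν, w ∈ s → ∃ p, p ∈ subgradientsOn s ψ w ∧ p ∈ subgradientsOn s χ w)
    (hu : u ∈ s) : ∃ p, p ∈ subgradientsOn s ψ u ∧ p ∈ subgradientsOn s χ u := by
  obtain ⟨w, hwmem, hw⟩ := mem_closure_iff_seq_limit.1 ((Measure.dense_of_ae h) u)
  obtain ⟨K, t, ht, hK⟩ := hψ.locallyLipschitzOn hs hu
  rw [hs.nhdsWithin_eq hu] at ht
  have hws : ∀ᶠ n in atTop, w n ∈ s := hw.eventually (hs.mem_nhds hu)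
  have hwt : ∀ᶠ n in atTop, t ∈ 𝓝 (w n) := hw.eventually (eventually_mem_nhds_iff.2 ht)
  have hbd : ∀ᶠ n in atTop, ∃ p, ‖p‖ ≤ K ∧ p ∈ subgradientsOn s ψ (w n) ∧
      p ∈ subgradientsOn s χ (w n) := by
    filter_upwards [hws, hwt] with n hn hnt
    obtain ⟨p, hp1, hp2⟩ := hwmem n hn
    exact ⟨p, norm_le_of_mem_subgradientsOn (hs.mem_nhds hn) hnt hK hp1, hp1, hp2⟩
  obtain ⟨N, hN⟩ := eventually_atTop.1 hbd
  choose! q hqK hqψ hqχ using hN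
  obtain ⟨p, -, k, hk, hkp⟩ := tendsto_subseq_of_bounded
    (Metric.isBounded_closedBall (x := (0 : E)) (r := K)) (x := fun n => q (n + N))
    (fun n => by simpa using hqK (n + N) (by omega))
  have hwk : Tendsto (fun n => w (k n + N)) atTop (𝓝 u) :=
    hw.comp ((tendsto_add_atTop_nat N).comp hk.tendsto_atTop)
  refine ⟨p, ?_, ?_⟩
  · exact mem_subgradientsOn_of_tendsto (Ψ := fun _ => ψ) (fun v _ => tendsto_const_nhds) hwk
      (((hψ.continuousOn hs).continuousAt (hs.mem_nhds hu)).tendsto.comp hwk) hkp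
      (Eventually.of_forall fun n => hqψ _ (by omega))
  · exact mem_subgradientsOn_of_tendsto (Ψ := fun _ => χ) (fun v _ => tendsto_const_nhds) hwk
      (((hχ.continuousOn hs).continuousAt (hs.mem_nhds hu)).tendsto.comp hwk) hkp
      (Eventually.of_forall fun n => hqχ _ (by omega))

end Convex

/-! ### The spherical uniform distribution and bounds from tightness -/

section Measure

variable {d : ℕ}

theorem ae_mem_ball_sphericalUniform :
    ∀ᵐ u ∂(sphericalUniform d), u ∈ Metric.ball (0 : EuclideanSpace ℝ (Fin d)) 1 := by
  rw [ae_iff, sphericalUniform]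
  change (volume.withDensity _) (Metric.ball (0 : EuclideanSpace ℝ (Fin d)) 1)ᶜ = 0
  rw [withDensity_apply _ Metric.isOpen_ball.measurableSet.compl]
  rw [setLIntegral_congr_fun (g := fun _ => 0) Metric.isOpen_ball.measurableSet.compl]
  · simp
  · intro x hx
    have : x ∉ Metric.ball (0 : EuclideanSpace ℝ (Fin d)) 1 \ {0} := fun h => hx h.1
    simp only [Set.indicator_of_notMem this, ENNReal.ofReal_zero]

theorem sphericalUniform_absolutelyContinuous : sphericalUniform d ≪ volume :=
  withDensity_absolutelyContinuous _ _

/-- The density of `U_d` is at least `1 / a_d` on the punctured ball. -/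
theorem exists_smul_volume_le_sphericalUniform (hd : 1 ≤ d) :
    ∃ κ : ENNReal, κ ≠ 0 ∧ κ • volume.restrict (Metric.ball (0 : EuclideanSpace ℝ (Fin d)) 1)
      ≤ sphericalUniform d := by
  have hd0 : (0 : ℝ) < d := by exact_mod_cast hd
  set a : ℝ := 2 * Real.pi ^ ((d : ℝ) / 2) / Real.Gamma ((d : ℝ) / 2) with ha
  have ha0 : 0 < a := by
    have := Real.Gamma_pos_of_pos (half_pos hd0)
    positivity
  have : Nonempty (Fin d) := ⟨⟨0, hd⟩⟩
  -- Positivity of `d` excludes the junk value of `Γ` at `0` and makes the origin a null set.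
  refine ⟨ENNReal.ofReal (1 / a), by simpa using ha0, ?_⟩
  rw [← withDensity_const, ← withDensity_indicator Metric.isOpen_ball.measurableSet,
    sphericalUniform]
  refine withDensity_mono ?_
  have h0 : ∀ᵐ x : EuclideanSpace ℝ (Fin d), x ≠ 0 := by simp [ae_iff]
  filter_upwards [h0] with x hx
  by_cases hxB : x ∈ Metric.ball (0 : EuclideanSpace ℝ (Fin d)) 1
  · have hxB' : x ∈ Metric.ball (0 : EuclideanSpace ℝ (Fin d)) 1 \ {0} := ⟨hxB, hx⟩
    rw [Set.indicator_of_mem hxB, Set.indicator_of_mem hxB']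
    refine ENNReal.ofReal_le_ofReal ?_
    rw [← ha]
    have hx0 : 0 < ‖x‖ := norm_pos_iff.2 hx
    have hx1 : ‖x‖ ≤ 1 := (mem_ball_zero_iff.1 hxB).le
    exact one_div_le_one_div_of_le (by positivity)
      (mul_le_of_le_one_right ha0.le (pow_le_one₀ hx0.le hx1))
  · simp [Set.indicator_of_notMem hxB]

theorem ae_volume_of_ae_sphericalUniform (hd : 1 ≤ d) {q : EuclideanSpace ℝ (Fin d) → Prop}
    (h : ∀ᵐ u ∂(sphericalUniform d), q u) :
    ∀ᵐ u : EuclideanSpace ℝ (Fin d), u ∈ Metric.ball (0 : EuclideanSpace ℝ (Fin d)) 1 → q u := by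
  obtain ⟨κ, hκ, hle⟩ := exists_smul_volume_le_sphericalUniform hd
  rw [← ae_restrict_iff' Metric.isOpen_ball.measurableSet]
  exact (Measure.absolutelyContinuous_smul hκ).ae_le
    ((Measure.absolutelyContinuous_of_le hle).ae_le h)

theorem measurable_gradient {E : Type*} [NormedAddCommGroup E] [InnerProductSpace ℝ E]
    [CompleteSpace E] [MeasurableSpace E] [BorelSpace E] (ψ : E → ℝ) : Measurable (gradient ψ) := by
  borelize (StrongDual ℝ E)
  exact (InnerProductSpace.toDual ℝ E).symm.continuous.measurable.comp (measurable_fderiv ℝ ψ)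

variable {P : Measure (EuclideanSpace ℝ (Fin d))} {ψ : EuclideanSpace ℝ (Fin d) → ℝ}

theorem IsQuantilePotential.isProbabilityMeasure [IsProbabilityMeasure P]
    (h : IsQuantilePotential P ψ) : IsProbabilityMeasure (sphericalUniform d) := by
  constructor
  have h1 : (sphericalUniform d).map (gradient ψ) Set.univ = 1 := by
    rw [h.map_gradient]
    exact measure_univ
  rwa [Measure.map_apply (measurable_gradient ψ) MeasurableSet.univ, Set.preimage_univ] at h1

theorem ae_differentiableAt_sphericalUniform
    (h : ConvexOn ℝ (Metric.ball (0 : EuclideanSpace ℝ (Fin d)) 1) ψ) :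
    ∀ᵐ u ∂(sphericalUniform d), DifferentiableAt ℝ ψ u := by
  filter_upwards [ae_mem_ball_sphericalUniform, sphericalUniform_absolutelyContinuous.ae_le
    (ae_differentiableAt_of_convexOn volume Metric.isOpen_ball h)] with u hu hd using hd hu

theorem ae_gradient_mem_subgradientsOn
    (h : ConvexOn ℝ (Metric.ball (0 : EuclideanSpace ℝ (Fin d)) 1) ψ) :
    ∀ᵐ u ∂(sphericalUniform d), gradient ψ u ∈ subgradientsOn (Metric.ball 0 1) ψ u := by
  filter_upwards [ae_mem_ball_sphericalUniform, ae_differentiableAt_sphericalUniform h] with u hu hd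
  exact gradient_mem_subgradientsOn Metric.isOpen_ball h hu hd

end Measure

section Bounds

variable {E : Type*} [NormedAddCommGroup E] [InnerProductSpace ℝ E]

/-- On each ball of radius less than one, the subgradients of all but finitely many of the
functions `Ψ m` are bounded by a common constant. -/
def LocallyBoundedSubgradients (Ψ : ℕ → E → ℝ) : Prop :=
  ∀ r < 1, ∃ C, ∀ᶠ m in atTop, ∀ u, ‖u‖ ≤ r →
    ∀ p ∈ subgradientsOn (Metric.ball 0 1) (Ψ m) u, ‖p‖ ≤ C

theorem LocallyBoundedSubgradients.comp {Ψ : ℕ → E → ℝ} (h : LocallyBoundedSubgradients Ψ)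
    {k : ℕ → ℕ} (hk : Tendsto k atTop atTop) :
    LocallyBoundedSubgradients (fun n => Ψ (k n)) := fun r hr =>
  let ⟨C, hC⟩ := h r hr
  ⟨C, hk.eventually hC⟩

/-- Monotonicity of the subdifferential: in the cone `⟨p, v - u⟩ ≥ ‖p‖ ‖v - u‖ / 3` all
subgradients have norm at least `‖p‖ / 3`, and this cone contains a ball whose radius only depends
on the distance of `u` to the unit sphere. -/
theorem exists_ball_norm_le_of_mem_subgradientsOn {ψ : E → ℝ} {u p : E} {t : ℝ} (ht : 0 < t)
    (hu : ‖u‖ ≤ 1 - 2 * t) (hp : p ∈ subgradientsOn (Metric.ball 0 1) ψ u) (hp0 : p ≠ 0) :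
    ∃ c, Metric.ball c (t / 2) ⊆ Metric.ball 0 1 ∧ ∀ v ∈ Metric.ball c (t / 2),
      ∀ q ∈ subgradientsOn (Metric.ball 0 1) ψ v, ‖p‖ ≤ 3 * ‖q‖ := by
  have hpn : 0 < ‖p‖ := norm_pos_iff.2 hp0
  set e : E := ‖p‖⁻¹ • p with he
  have hen : ‖e‖ = 1 := by rw [he, norm_smul, norm_inv, norm_norm, inv_mul_cancel₀ hpn.ne']
  have hpe : inner ℝ p e = ‖p‖ := by
    rw [he, inner_smul_right, real_inner_self_eq_norm_sq]
    field_simp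
  have hsub : Metric.ball (u + t • e) (t / 2) ⊆ Metric.ball (0 : E) 1 := by
    intro v hv
    rw [mem_ball_iff_norm] at hv
    rw [mem_ball_zero_iff]
    calc ‖v‖ = ‖(v - (u + t • e)) + (u + t • e)‖ := by simp
      _ ≤ ‖v - (u + t • e)‖ + (‖u‖ + ‖t • e‖) :=
        (norm_add_le _ _).trans (by gcongr; exact norm_add_le _ _)
      _ < 1 := by
        rw [norm_smul, hen, Real.norm_of_nonneg ht.le]
        linarith
  refine ⟨u + t • e, hsub, fun v hv q hq => ?_⟩
  have huB : u ∈ Metric.ball (0 : E) 1 := by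
    rw [mem_ball_zero_iff]
    linarith
  have h1 := hp v (hsub hv)
  have h2 := hq u huB
  set w := v - (u + t • e) with hw
  have hwn : ‖w‖ < t / 2 := mem_ball_iff_norm.1 hv
  have hvu : v - u = t • e + w := by rw [hw]; abel
  have h3 : ‖p‖ * (t / 2) ≤ inner ℝ p (v - u) := by
    have h4 : -(‖p‖ * ‖w‖) ≤ inner ℝ p w := neg_le_of_abs_le (abs_real_inner_le_norm p w)
    rw [hvu, inner_add_right, inner_smul_right, hpe]
    nlinarith
  have h5 : ‖v - u‖ ≤ 3 * (t / 2) := by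
    rw [hvu]
    refine (norm_add_le _ _).trans ?_
    rw [norm_smul, hen, Real.norm_of_nonneg ht.le]
    linarith
  have h6 : inner ℝ q (v - u) ≤ ‖q‖ * ‖v - u‖ := real_inner_le_norm _ _
  have h7 : inner ℝ q (u - v) = -inner ℝ q (v - u) := by rw [← inner_neg_right, neg_sub]
  have h8 : ‖q‖ * ‖v - u‖ ≤ ‖q‖ * (3 * (t / 2)) := by gcongr
  have h9 : ‖p‖ * (t / 2) ≤ (3 * ‖q‖) * (t / 2) := by linarith
  exact le_of_mul_le_mul_right h9 (by positivity)

end Bounds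

/-- Tightness of `μ m` bounds the subgradients: a large subgradient at `u` would force the gradient
to be large on a ball, hence with a `U_d`-probability bounded away from zero. -/
theorem locallyBoundedSubgradients_of_tendsto {d : ℕ} (hd : 1 ≤ d)
    {μ : ℕ → ProbabilityMeasure (EuclideanSpace ℝ (Fin d))}
    {P : ProbabilityMeasure (EuclideanSpace ℝ (Fin d))}
    {Ψ : ℕ → EuclideanSpace ℝ (Fin d) → ℝ}
    (hΨ : ∀ m, IsQuantilePotential (μ m : Measure (EuclideanSpace ℝ (Fin d))) (Ψ m))
    (hμ : Tendsto μ atTop (𝓝 P)) : LocallyBoundedSubgradients Ψ := by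
  intro r hr
  obtain ⟨κ, hκ, hle⟩ := exists_smul_volume_le_sphericalUniform hd
  set t : ℝ := (1 - r) / 2 with ht
  have ht0 : 0 < t := by linarith
  set η : ENNReal := κ * volume (Metric.ball (0 : EuclideanSpace ℝ (Fin d)) (t / 2)) with hη
  have hη0 : 0 < η :=
    pos_iff_ne_zero.2 (mul_ne_zero hκ (Metric.measure_ball_pos _ _ (by positivity)).ne')
  obtain ⟨ε, hε0, hεη⟩ := exists_between hη0
  obtain ⟨K, hK, hKε⟩ := isTightMeasureSet_iff_exists_isCompact_measure_compl_le.1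
    (isTightMeasureSet_singleton (μ := (P : Measure (EuclideanSpace ℝ (Fin d))))) ε hε0
  obtain ⟨R, hR0, hKR⟩ := hK.isBounded.subset_ball_lt 0 0
  set A : Set (EuclideanSpace ℝ (Fin d)) := {x | R ≤ ‖x‖} with hA
  have hAc : IsClosed A := isClosed_le continuous_const continuous_norm
  have hPA : (P : Measure (EuclideanSpace ℝ (Fin d))) A < η := by
    refine ((measure_mono fun x hx hxK => ?_).trans (hKε _ rfl)).trans_lt hεη
    have h1 := mem_ball_zero_iff.1 (hKR hxK)
    have h2 : R ≤ ‖x‖ := hx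
    linarith
  have hlim := (ProbabilityMeasure.limsup_measure_closed_le_of_tendsto hμ hAc).trans_lt hPA
  refine ⟨3 * R, ?_⟩
  filter_upwards [eventually_lt_of_limsup_lt hlim] with m hm u hu p hp
  by_contra! hpR
  have hp0 : p ≠ 0 := by
    rintro rfl
    rw [norm_zero] at hpR
    linarith
  obtain ⟨c, hcB, hc⟩ := exists_ball_norm_le_of_mem_subgradientsOn ht0 (by linarith) hp hp0
  have h1 : η ≤ sphericalUniform d (Metric.ball c (t / 2)) := by
    refine le_trans (le_of_eq ?_) (hle _)
    rw [hη, Measure.smul_apply, smul_eq_mul, Measure.restrict_apply Metric.isOpen_ball.measurableSet,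
      Set.inter_eq_left.2 hcB, Measure.addHaar_ball_center volume c]
  have h2 : sphericalUniform d (Metric.ball c (t / 2))
      ≤ sphericalUniform d (gradient (Ψ m) ⁻¹' A) := by
    refine measure_mono_ae ?_
    filter_upwards [ae_gradient_mem_subgradientsOn (hΨ m).convexOn] with v hv hvc
    have h3 := hc v hvc _ hv
    change R ≤ ‖gradient (Ψ m) v‖
    linarith
  rw [← Measure.map_apply (measurable_gradient _) hAc.measurableSet, (hΨ m).map_gradient] at h2
  exact absurd (h1.trans h2) (not_le.2 hm)

/-! ### Compactness of families of potentials -/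

section Compactness

theorem convexOn_of_tendsto {E : Type*} [NormedAddCommGroup E] [InnerProductSpace ℝ E]
    {Ψ : ℕ → E → ℝ} {ψ : E → ℝ} {s : Set E} (hΨ : ∀ m, ConvexOn ℝ s (Ψ m))
    (hlim : ∀ u ∈ s, Tendsto (fun m => Ψ m u) atTop (𝓝 (ψ u))) : ConvexOn ℝ s ψ :=
  ⟨(hΨ 0).1, fun x hx y hy a b ha hb hab =>
    le_of_tendsto_of_tendsto' (hlim _ ((hΨ 0).1 hx hy ha hb hab))
      (((hlim x hx).const_smul a).add ((hlim y hy).const_smul b))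
      fun m => (hΨ m).2 hx hy ha hb hab⟩

variable {E : Type*} [NormedAddCommGroup E] [InnerProductSpace ℝ E] [FiniteDimensional ℝ E]
  {Ψ : ℕ → E → ℝ} {ψ : E → ℝ}

theorem LocallyBoundedSubgradients.eventually_abs_sub_le (h : LocallyBoundedSubgradients Ψ)
    (hΨ : ∀ m, ConvexOn ℝ (Metric.ball 0 1) (Ψ m)) {r : ℝ} (hr : r < 1) :
    ∃ C, 0 ≤ C ∧ ∀ᶠ m in atTop, ∀ u v, ‖u‖ ≤ r → ‖v‖ ≤ r → |Ψ m u - Ψ m v| ≤ C * ‖u - v‖ := by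
  obtain ⟨C, hC⟩ := h r hr
  refine ⟨max C 0, le_max_right _ _, hC.mono fun m hm => ?_⟩
  have key : ∀ u v, ‖u‖ ≤ r → ‖v‖ ≤ r → Ψ m u - Ψ m v ≤ max C 0 * ‖u - v‖ := by
    intro u v hu hv
    obtain ⟨p, hp⟩ := exists_mem_subgradientsOn Metric.isOpen_ball (hΨ m)
      (mem_ball_zero_iff.2 (hu.trans_lt hr))
    exact sub_le_of_subgradientsOn_norm_le hp (mem_ball_zero_iff.2 (hv.trans_lt hr))
      ((hm u hu p hp).trans (le_max_left _ _))
  intro u v hu hv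
  refine abs_le.2 ⟨?_, key u v hu hv⟩
  have := key v u hv hu
  rw [norm_sub_rev] at this
  linarith

theorem LocallyBoundedSubgradients.eventually_abs_le (h : LocallyBoundedSubgradients Ψ)
    (hΨ : ∀ m, ConvexOn ℝ (Metric.ball 0 1) (Ψ m)) (h0 : ∀ m, Ψ m 0 = 0) {r : ℝ} (hr : r < 1) :
    ∃ C, 0 ≤ C ∧ ∀ᶠ m in atTop, ∀ u, ‖u‖ ≤ r → |Ψ m u| ≤ C := by
  obtain ⟨C, hC0, hC⟩ := h.eventually_abs_sub_le hΨ hr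
  refine ⟨C, hC0, hC.mono fun m hm u hu => ?_⟩
  have h1 := hm u 0 hu (by simpa using (norm_nonneg u).trans hu)
  rw [h0, sub_zero, sub_zero] at h1
  exact h1.trans (mul_le_of_le_one_right hC0 (hu.trans hr.le))

theorem LocallyBoundedSubgradients.tendsto_apply (h : LocallyBoundedSubgradients Ψ)
    (hΨ : ∀ m, ConvexOn ℝ (Metric.ball 0 1) (Ψ m))
    (hlim : ∀ u ∈ Metric.ball (0 : E) 1, Tendsto (fun m => Ψ m u) atTop (𝓝 (ψ u)))
    {w : ℕ → E} {u : E} (hu : u ∈ Metric.ball (0 : E) 1) (hw : Tendsto w atTop (𝓝 u)) :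
    Tendsto (fun m => Ψ m (w m)) atTop (𝓝 (ψ u)) := by
  obtain ⟨r, hur, hr⟩ := exists_between (mem_ball_zero_iff.1 hu)
  obtain ⟨C, -, hC⟩ := h.eventually_abs_sub_le hΨ hr
  have hdiff : Tendsto (fun m => Ψ m (w m) - Ψ m u) atTop (𝓝 0) := by
    refine squeeze_zero_norm' (a := fun m => C * ‖w m - u‖) ?_ ?_
    · filter_upwards [hC, hw.norm.eventually (gt_mem_nhds hur)] with m hm hwm
      exact hm _ _ hwm.le hur.le
    · simpa using (tendsto_iff_norm_sub_tendsto_zero.1 hw).const_mul C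
  simpa using hdiff.add (hlim u hu)

/-- Diagonal extraction on a countable dense set, then equicontinuity. -/
theorem LocallyBoundedSubgradients.exists_subseq_tendsto (h : LocallyBoundedSubgradients Ψ)
    (hΨ : ∀ m, ConvexOn ℝ (Metric.ball 0 1) (Ψ m)) (h0 : ∀ m, Ψ m 0 = 0) :
    ∃ (ψ : E → ℝ) (k : ℕ → ℕ), StrictMono k ∧
      ∀ u ∈ Metric.ball (0 : E) 1, Tendsto (fun n => Ψ (k n) u) atTop (𝓝 (ψ u)) := by
  classical
  set D := TopologicalSpace.denseSeq E
  set a : ℕ → ℕ → ℝ := fun m i => if D i ∈ Metric.ball (0 : E) 1 then Ψ m (D i) else 0 with ha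
  have hbd : ∀ i, ∃ C, ∀ m, |a m i| ≤ C := by
    intro i
    by_cases hi : D i ∈ Metric.ball (0 : E) 1
    · obtain ⟨C, -, hC⟩ := h.eventually_abs_le hΨ h0 (mem_ball_zero_iff.1 hi)
      obtain ⟨C', hC'⟩ := (isBoundedUnder_of_eventually_le (f := atTop)
        (u := fun m => |Ψ m (D i)|) (hC.mono fun m hm => hm _ le_rfl)).bddAbove_range
      exact ⟨C', fun m => by simpa only [ha, if_pos hi] using hC' ⟨m, rfl⟩⟩
    · exact ⟨0, fun m => by simp only [ha, if_neg hi, abs_zero, le_refl]⟩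
  choose C hC using hbd
  obtain ⟨b, -, k, hk, hkb⟩ := (isCompact_univ_pi fun i => isCompact_Icc (a := -C i)
    (b := C i)).tendsto_subseq (x := a) fun m i _ => abs_le.1 (hC i m)
  have hconv : ∀ u ∈ Metric.ball (0 : E) 1, ∃ y, Tendsto (fun n => Ψ (k n) u) atTop (𝓝 y) := by
    intro u hu
    refine cauchySeq_tendsto_of_complete (Metric.cauchySeq_iff'.2 fun ε hε => ?_)
    obtain ⟨r, hur, hr⟩ := exists_between (mem_ball_zero_iff.1 hu)
    obtain ⟨L, hL0, hL⟩ := (h.comp hk.tendsto_atTop).eventually_abs_sub_le (fun n => hΨ (k n)) hr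
    obtain ⟨i, hi, hir⟩ : ∃ i, L * ‖u - D i‖ < ε / 3 ∧ ‖D i‖ < r := by
      have hopen : IsOpen {x : E | L * ‖u - x‖ < ε / 3 ∧ ‖x‖ < r} :=
        (isOpen_lt (f := fun x => L * ‖u - x‖) (by fun_prop) continuous_const).inter
          (isOpen_lt continuous_norm continuous_const)
      exact (TopologicalSpace.denseRange_denseSeq E).exists_mem_open hopen
        ⟨u, by simpa using hε, hur⟩
    have hiB : D i ∈ Metric.ball (0 : E) 1 := mem_ball_zero_iff.2 (hir.trans hr)
    have hcau : CauchySeq fun n => Ψ (k n) (D i) := by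
      have := ((tendsto_pi_nhds.1 hkb) i).cauchySeq
      simpa only [Function.comp_def, ha, if_pos hiB] using this
    obtain ⟨N, hN⟩ := Metric.cauchySeq_iff.1 hcau (ε / 3) (by positivity)
    obtain ⟨M, hM⟩ := eventually_atTop.1 hL
    refine ⟨max N M, fun n hn => ?_⟩
    have h1 := hM n ((le_max_right _ _).trans hn) u (D i) hur.le hir.le
    have h2 := hM (max N M) (le_max_right _ _) u (D i) hur.le hir.le
    have h3 := hN n ((le_max_left _ _).trans hn) (max N M) (le_max_left _ _)
    rw [Real.dist_eq, abs_lt] at *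
    rw [abs_le] at h1 h2
    constructor <;> linarith
  choose! ψ hψ using hconv
  exact ⟨ψ, k, hk, hψ⟩

theorem LocallyBoundedSubgradients.tendsto_gradient (h : LocallyBoundedSubgradients Ψ)
    (hΨ : ∀ m, ConvexOn ℝ (Metric.ball 0 1) (Ψ m))
    (hlim : ∀ u ∈ Metric.ball (0 : E) 1, Tendsto (fun m => Ψ m u) atTop (𝓝 (ψ u)))
    {u : E} (hu : u ∈ Metric.ball (0 : E) 1) (hd : ∀ m, DifferentiableAt ℝ (Ψ m) u)
    (hdψ : DifferentiableAt ℝ ψ u) :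
    Tendsto (fun m => gradient (Ψ m) u) atTop (𝓝 (gradient ψ u)) := by
  have hmem := fun m => gradient_mem_subgradientsOn Metric.isOpen_ball (hΨ m) hu (hd m)
  obtain ⟨C, hC⟩ := h ‖u‖ (mem_ball_zero_iff.1 hu)
  refine tendsto_of_subseq_tendsto fun ns hns => ?_
  obtain ⟨p, -, k, hk, hkp⟩ := tendsto_subseq_of_frequently_bounded
    (Metric.isBounded_closedBall (x := (0 : E)) (r := C)) (x := fun n => gradient (Ψ (ns n)) u)
    ((hns.eventually hC).mono fun n hn => by simpa using hn u le_rfl _ (hmem _)).frequently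
  have hnk := hns.comp hk.tendsto_atTop
  have hp : p ∈ subgradientsOn (Metric.ball 0 1) ψ u :=
    mem_subgradientsOn_of_tendsto (Ψ := fun n => Ψ (ns (k n))) (fun v hv => (hlim v hv).comp hnk)
      tendsto_const_nhds ((hlim u hu).comp hnk) hkp (Eventually.of_forall fun n => hmem _)
  refine ⟨k, ?_⟩
  rwa [← eq_gradient_of_mem_subgradientsOn (Metric.isOpen_ball.mem_nhds hu) hdψ hp]

end Compactness

variable {d : ℕ}

/-- Pointwise limits of quantile potentials are quantile potentials of the weak limit, because the
gradients converge almost everywhere. -/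
theorem IsQuantilePotential.of_tendsto
    {μ : ℕ → ProbabilityMeasure (EuclideanSpace ℝ (Fin d))}
    {P : ProbabilityMeasure (EuclideanSpace ℝ (Fin d))}
    {Ψ : ℕ → EuclideanSpace ℝ (Fin d) → ℝ} {ψ : EuclideanSpace ℝ (Fin d) → ℝ}
    (hΨ : ∀ m, IsQuantilePotential (μ m : Measure (EuclideanSpace ℝ (Fin d))) (Ψ m))
    (hb : LocallyBoundedSubgradients Ψ) (hμ : Tendsto μ atTop (𝓝 P))
    (hlim : ∀ u ∈ Metric.ball 0 1, Tendsto (fun m => Ψ m u) atTop (𝓝 (ψ u))) :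
    IsQuantilePotential (P : Measure (EuclideanSpace ℝ (Fin d))) ψ := by
  have hconv : ConvexOn ℝ (Metric.ball 0 1) ψ :=
    convexOn_of_tendsto (fun m => (hΨ m).convexOn) hlim
  have hprob : IsProbabilityMeasure (sphericalUniform d) := (hΨ 0).isProbabilityMeasure
  have hmap : IsProbabilityMeasure ((sphericalUniform d).map (gradient ψ)) :=
    Measure.isProbabilityMeasure_map (measurable_gradient ψ).aemeasurable
  refine ⟨hconv, ?_, ?_⟩
  · have := hlim 0 (by simp)
    simp only [(hΨ _).map_zero] at this
    exact (tendsto_nhds_unique this tendsto_const_nhds)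
  · refine ext_of_forall_integral_eq_of_IsFiniteMeasure fun f => ?_
    have h1 := ProbabilityMeasure.tendsto_iff_forall_integral_tendsto.1 hμ f
    refine tendsto_nhds_unique ?_ h1
    have h2 : ∀ m, ∫ x, f x ∂(μ m : Measure (EuclideanSpace ℝ (Fin d)))
        = ∫ u, f (gradient (Ψ m) u) ∂(sphericalUniform d) := by
      intro m
      rw [← (hΨ m).map_gradient, integral_map (measurable_gradient _).aemeasurable
        f.continuous.aestronglyMeasurable]
    simp_rw [h2]
    rw [integral_map (measurable_gradient _).aemeasurable f.continuous.aestronglyMeasurable]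
    refine tendsto_integral_of_dominated_convergence (fun _ => ‖f‖)
      (fun m => (f.continuous.measurable.comp (measurable_gradient _)).aestronglyMeasurable)
      (integrable_const _) (fun m => Eventually.of_forall fun u => f.norm_coe_le_norm _) ?_
    filter_upwards [ae_mem_ball_sphericalUniform, ae_differentiableAt_sphericalUniform hconv,
      ae_all_iff.2 fun m => ae_differentiableAt_sphericalUniform (hΨ m).convexOn] with u hu hdψ hd
    exact (f.continuous.tendsto _).comp
      (hb.tendsto_gradient (fun m => (hΨ m).convexOn) hlim hu hd hdψ)

/-! ### Conjugates and uniqueness of the quantile potential -/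

section Conjugate

variable {d : ℕ} {ψ : EuclideanSpace ℝ (Fin d) → ℝ} {x y u p : EuclideanSpace ℝ (Fin d)}

theorem bddAbove_range_conjugate (h : ConvexOn ℝ (Metric.ball 0 1) ψ)
    (x : EuclideanSpace ℝ (Fin d)) :
    BddAbove (Set.range fun u : Metric.ball (0 : EuclideanSpace ℝ (Fin d)) 1 =>
      (inner ℝ x (u : EuclideanSpace ℝ (Fin d)) - ψ u)) := by
  obtain ⟨p, hp⟩ := exists_mem_subgradientsOn Metric.isOpen_ball h (u := 0) (by simp)
  refine ⟨‖x - p‖ - ψ 0, ?_⟩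
  rintro _ ⟨⟨u, hu⟩, rfl⟩
  have h1 := hp u hu
  have h2 : inner ℝ (x - p) u ≤ ‖x - p‖ * ‖u‖ := real_inner_le_norm _ _
  have h3 : ‖x - p‖ * ‖u‖ ≤ ‖x - p‖ :=
    mul_le_of_le_one_right (norm_nonneg _) (mem_ball_zero_iff.1 hu).le
  rw [sub_zero] at h1
  rw [inner_sub_left] at h2
  dsimp only
  linarith

theorem inner_sub_le_conjugate (h : ConvexOn ℝ (Metric.ball 0 1) ψ) (hu : u ∈ Metric.ball 0 1) :
    inner ℝ x u - ψ u ≤ conjugate ψ x :=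
  le_ciSup (bddAbove_range_conjugate h x) ⟨u, hu⟩

theorem conjugate_le {a : ℝ} (h : ∀ u ∈ Metric.ball 0 1, inner ℝ x u - ψ u ≤ a) :
    conjugate ψ x ≤ a := by
  have : Nonempty (Metric.ball (0 : EuclideanSpace ℝ (Fin d)) 1) := ⟨⟨0, by simp⟩⟩
  exact ciSup_le fun u => h u u.2

/-- The equality case of the Fenchel–Young inequality. -/
theorem conjugate_eq_of_mem_subgradientsOn (h : ConvexOn ℝ (Metric.ball 0 1) ψ)
    (hu : u ∈ Metric.ball 0 1) (hp : p ∈ subgradientsOn (Metric.ball 0 1) ψ u) :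
    conjugate ψ p = inner ℝ p u - ψ u := by
  refine le_antisymm (conjugate_le fun v hv => ?_) (inner_sub_le_conjugate h hu)
  have := hp v hv
  rw [inner_sub_right] at this
  linarith

theorem mem_subdifferential_conjugate (h : ConvexOn ℝ (Metric.ball 0 1) ψ)
    (hu : u ∈ Metric.ball 0 1) (hp : p ∈ subgradientsOn (Metric.ball 0 1) ψ u) :
    u ∈ subdifferential (conjugate ψ) p := by
  intro z
  have h1 := inner_sub_le_conjugate (x := z) h hu
  rw [conjugate_eq_of_mem_subgradientsOn h hu hp, inner_sub_right, real_inner_comm z u,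
    real_inner_comm p u]
  linarith

theorem mem_subgradientsOn_of_mem_subdifferential (h : ConvexOn ℝ (Metric.ball 0 1) ψ)
    (hu : u ∈ Metric.ball 0 1) (hp : u ∈ subdifferential (conjugate ψ) p) :
    p ∈ subgradientsOn (Metric.ball 0 1) ψ u := by
  obtain ⟨q, hq⟩ := exists_mem_subgradientsOn Metric.isOpen_ball h hu
  intro v hv
  have h1 := hp q
  have h2 := inner_sub_le_conjugate (x := p) h hv
  rw [conjugate_eq_of_mem_subgradientsOn h hu hq, inner_sub_right, real_inner_comm q u,
    real_inner_comm p u] at h1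
  rw [inner_sub_right]
  linarith

theorem conjugate_sub_le (h : ConvexOn ℝ (Metric.ball 0 1) ψ)
    (x y : EuclideanSpace ℝ (Fin d)) : conjugate ψ x - conjugate ψ y ≤ ‖x - y‖ := by
  rw [sub_le_iff_le_add]
  refine conjugate_le fun u hu => ?_
  have h1 := inner_sub_le_conjugate (x := y) h hu
  have h2 : inner ℝ (x - y) u ≤ ‖x - y‖ * ‖u‖ := real_inner_le_norm _ _
  have h3 : ‖x - y‖ * ‖u‖ ≤ ‖x - y‖ :=
    mul_le_of_le_one_right (norm_nonneg _) (mem_ball_zero_iff.1 hu).le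
  rw [inner_sub_left] at h2
  linarith

theorem norm_le_one_of_mem_subdifferential (h : ConvexOn ℝ (Metric.ball 0 1) ψ)
    (hy : y ∈ subdifferential (conjugate ψ) x) : ‖y‖ ≤ 1 := by
  have h1 := hy (x + y)
  have h2 := conjugate_sub_le h (x + y) x
  rw [add_sub_cancel_left, real_inner_self_eq_norm_sq] at h1
  rw [add_sub_cancel_left] at h2
  nlinarith [norm_nonneg y]

theorem conjugate_nonneg (h : ConvexOn ℝ (Metric.ball 0 1) ψ) (h0 : ψ 0 = 0)
    (x : EuclideanSpace ℝ (Fin d)) : 0 ≤ conjugate ψ x := by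
  simpa [h0] using inner_sub_le_conjugate (x := x) (u := 0) h (by simp)

/-- A subgradient of the conjugate at a distant point `x` is close to the direction of `x`. -/
theorem norm_sub_direction_sq_le {r C : ℝ} (hr0 : 0 ≤ r) (hr : r < 1)
    (h : ConvexOn ℝ (Metric.ball 0 1) ψ)
    (hC : ∀ u, ‖u‖ ≤ r → ψ u ≤ C) (hx : x ≠ 0) (hy : y ∈ subdifferential (conjugate ψ) x) :
    ‖y - ‖x‖⁻¹ • x‖ ^ 2 ≤ 2 * (1 - r) + 2 * (C + conjugate ψ 0) / ‖x‖ := by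
  have hxn : 0 < ‖x‖ := norm_pos_iff.2 hx
  set e := ‖x‖⁻¹ • x with he
  have hen : ‖e‖ = 1 := by rw [he, norm_smul, norm_inv, norm_norm, inv_mul_cancel₀ hxn.ne']
  have hxe : x = ‖x‖ • e := by rw [he, smul_smul, mul_inv_cancel₀ hxn.ne', one_smul]
  have hyn := norm_le_one_of_mem_subdifferential h hy
  have hre : ‖r • e‖ = r := by rw [norm_smul, hen, mul_one, Real.norm_of_nonneg hr0]
  have h1 := inner_sub_le_conjugate (x := x) h (u := r • e)
    (by rw [mem_ball_zero_iff, hre]; exact hr)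
  have h2 := hy 0
  have h3 := hC (r • e) hre.le
  have h4 : inner ℝ x (r • e) = r * ‖x‖ := by
    nth_rewrite 1 [hxe]
    rw [inner_smul_left, inner_smul_right, real_inner_self_eq_norm_sq, hen]
    simp [mul_comm]
  have h5 : inner ℝ y (0 - x) = -(‖x‖ * inner ℝ y e) := by
    nth_rewrite 1 [hxe]
    rw [zero_sub, inner_neg_right, inner_smul_right]
  have h6 : r - (C + conjugate ψ 0) / ‖x‖ ≤ inner ℝ y e := by
    rw [sub_le_iff_le_add, ← sub_le_iff_le_add', le_div_iff₀ hxn]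
    nlinarith
  rw [norm_sub_sq_real, hen, mul_div_assoc]
  nlinarith [norm_nonneg y]

/-- Uniqueness of the quantile potential. The map `T = F ∘ ∇χ` preserves `U_d`, and the difference
`ψ - χ` does not increase along `T`, hence is almost everywhere invariant. This is the equality
case of the subgradient inequalities, and says that `∇χ` is also a subgradient of `ψ`. -/
theorem IsQuantilePotential.eqOn_ball (hd : 1 ≤ d) {P : Measure (EuclideanSpace ℝ (Fin d))}
    [IsProbabilityMeasure P] {χ : EuclideanSpace ℝ (Fin d) → ℝ}
    {F : EuclideanSpace ℝ (Fin d) → EuclideanSpace ℝ (Fin d)} (hψ : IsQuantilePotential P ψ)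
    (hF : ∀ x, subdifferential (conjugate ψ) x = {F x}) (hFm : Measurable F)
    (hχ : IsQuantilePotential P χ) : Set.EqOn χ ψ (Metric.ball 0 1) := by
  have hprob := hψ.isProbabilityMeasure
  set U := sphericalUniform d with hU
  set B := Metric.ball (0 : EuclideanSpace ℝ (Fin d)) 1 with hB
  set T := fun u => F (gradient χ u) with hT
  have hTm : Measurable T := hFm.comp (measurable_gradient χ)
  -- Both `∇χ` and `∇ψ` push `U_d` forward to `P`, and `F ∘ ∇ψ` is almost everywhere the identity.
  have hTU : U.map T = U := by
    rw [hT, ← Function.comp_def, ← Measure.map_map hFm (measurable_gradient χ), hχ.map_gradient,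
      ← hψ.map_gradient, Measure.map_map hFm (measurable_gradient ψ)]
    refine (Measure.map_congr (g := id) ?_).trans Measure.map_id
    filter_upwards [ae_mem_ball_sphericalUniform, ae_gradient_mem_subgradientsOn hψ.convexOn]
      with u hu hp
    have h1 := mem_subdifferential_conjugate hψ.convexOn hu hp
    rw [hF] at h1
    exact h1.symm
  have hTB : ∀ᵐ u ∂U, T u ∈ B := by
    refine ae_of_ae_map hTm.aemeasurable ?_
    rw [hTU]
    exact ae_mem_ball_sphericalUniform
  have hTψ : ∀ᵐ u ∂U, gradient χ u ∈ subgradientsOn B ψ (T u) := by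
    filter_upwards [hTB] with u hu
    refine mem_subgradientsOn_of_mem_subdifferential hψ.convexOn hu ?_
    rw [hF]
    rfl
  -- `ψ - χ` need not be integrable, so it is composed with a bounded strictly monotone function.
  set g := fun u => Real.arctan (ψ u - χ u) with hg
  have hgm : AEStronglyMeasurable g U := by
    have hc : ContinuousOn g B := Real.continuous_arctan.comp_continuousOn
      ((hψ.convexOn.continuousOn Metric.isOpen_ball).sub
        (hχ.convexOn.continuousOn Metric.isOpen_ball))
    have := hc.aestronglyMeasurable (μ := U) Metric.isOpen_ball.measurableSet
    rwa [Measure.restrict_eq_self_of_ae_mem ae_mem_ball_sphericalUniform] at this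
  have hgi : Integrable g U := Integrable.of_bound hgm (Real.pi / 2)
    (Eventually.of_forall fun u => abs_le.2
      ⟨by linarith [Real.neg_pi_div_two_lt_arctan (ψ u - χ u)], (Real.arctan_lt_pi_div_two _).le⟩)
  have hgTi : Integrable (g ∘ T) U := by
    refine Integrable.comp_measurable ?_ hTm
    rwa [hTU]
  have hgT : g ∘ T ≤ᵐ[U] g := by
    filter_upwards [ae_mem_ball_sphericalUniform, hTB, hTψ,
      ae_gradient_mem_subgradientsOn hχ.convexOn] with u hu hTu h1 h2
    refine Real.arctan_strictMono.monotone ?_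
    have h3 := h1 u hu
    have h4 := h2 (T u) hTu
    rw [← neg_sub, inner_neg_right] at h4
    linarith
  have hint : ∫ u, (g ∘ T) u ∂U = ∫ u, g u ∂U := by
    nth_rewrite 2 [← hTU]
    rw [integral_map hTm.aemeasurable (by rwa [hTU])]
    rfl
  have heq : g ∘ T =ᵐ[U] g := (integral_eq_iff_of_ae_le hgTi hgi hgT).1 hint
  have hcommon : ∀ᵐ u ∂U, ∃ p, p ∈ subgradientsOn B ψ u ∧ p ∈ subgradientsOn B χ u := by
    filter_upwards [ae_mem_ball_sphericalUniform, hTB, hTψ,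
      ae_gradient_mem_subgradientsOn hχ.convexOn, heq] with u hu hTu h1 h2 h3
    refine ⟨gradient χ u, fun v hv => ?_, h2⟩
    have h3 : ψ (T u) - χ (T u) = ψ u - χ u := Real.arctan_injective h3
    have h4 := h1 v hv
    have h5 := h2 (T u) hTu
    rw [inner_sub_right] at h4 h5 ⊢
    linarith
  have hall : ∀ w ∈ B, ∃ p, p ∈ subgradientsOn B ψ w ∧ p ∈ subgradientsOn B χ w := fun w hw =>
    exists_common_subgradient_of_ae volume Metric.isOpen_ball hψ.convexOn hχ.convexOn
      (ae_volume_of_ae_sphericalUniform hd hcommon) hw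
  intro u hu
  have h0 : (0 : EuclideanSpace ℝ (Fin d)) ∈ B := by simp [hB]
  have h1 := sub_le_sub_of_common_subgradients (convex_ball 0 1) hall hu h0
  have h2 := sub_le_sub_of_common_subgradients (convex_ball 0 1) hall h0 hu
  rw [hψ.map_zero, hχ.map_zero] at h1 h2
  linarith

end Conjugate

/-! ### Convergence of the conjugates and of the distribution functions -/

section Convergence

variable {d : ℕ} {Ψ : ℕ → EuclideanSpace ℝ (Fin d) → ℝ} {ψ : EuclideanSpace ℝ (Fin d) → ℝ}

/-- Every subsequence of the potentials has a pointwise convergent subsequence, whose limit is a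
quantile potential of the weak limit and therefore equals `ψ`. -/
theorem IsQuantilePotential.tendsto_of_tendsto (hd : 1 ≤ d)
    {μ : ℕ → ProbabilityMeasure (EuclideanSpace ℝ (Fin d))}
    {P : ProbabilityMeasure (EuclideanSpace ℝ (Fin d))}
    {F : EuclideanSpace ℝ (Fin d) → EuclideanSpace ℝ (Fin d)}
    (hΨ : ∀ m, IsQuantilePotential (μ m : Measure (EuclideanSpace ℝ (Fin d))) (Ψ m))
    (hμ : Tendsto μ atTop (𝓝 P))
    (hψ : IsQuantilePotential (P : Measure (EuclideanSpace ℝ (Fin d))) ψ)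
    (hF : ∀ x, subdifferential (conjugate ψ) x = {F x}) (hFm : Measurable F)
    {u : EuclideanSpace ℝ (Fin d)} (hu : u ∈ Metric.ball 0 1) :
    Tendsto (fun m => Ψ m u) atTop (𝓝 (ψ u)) := by
  refine tendsto_of_subseq_tendsto fun ns hns => ?_
  have hb := (locallyBoundedSubgradients_of_tendsto hd hΨ hμ).comp hns
  obtain ⟨χ, k, hk, hlim⟩ :=
    hb.exists_subseq_tendsto (fun n => (hΨ _).convexOn) (fun n => (hΨ _).map_zero)
  have hχ : IsQuantilePotential (P : Measure (EuclideanSpace ℝ (Fin d))) χ :=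
    .of_tendsto (fun n => hΨ (ns (k n))) (hb.comp hk.tendsto_atTop)
      (hμ.comp (hns.comp hk.tendsto_atTop)) hlim
  refine ⟨k, ?_⟩
  rw [← hψ.eqOn_ball hd hF hFm hχ hu]
  exact hlim u hu

/-- Since `Ψ m 0 = 0`, convexity gives `r * φ_m x ≤ sup_{‖u‖ < r} (⟨x, u⟩ - Ψ m u)`, so the values
of the potentials near the unit sphere are not needed. -/
theorem LocallyBoundedSubgradients.tendsto_conjugate (h : LocallyBoundedSubgradients Ψ)
    (hΨ : ∀ m, ConvexOn ℝ (Metric.ball 0 1) (Ψ m)) (h0 : ∀ m, Ψ m 0 = 0)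
    (hlim : ∀ u ∈ Metric.ball 0 1, Tendsto (fun m => Ψ m u) atTop (𝓝 (ψ u)))
    (x : EuclideanSpace ℝ (Fin d)) :
    Tendsto (fun m => conjugate (Ψ m) x) atTop (𝓝 (conjugate ψ x)) := by
  have : Nonempty (Metric.ball (0 : EuclideanSpace ℝ (Fin d)) 1) := ⟨⟨0, by simp⟩⟩
  have hψ : ConvexOn ℝ (Metric.ball 0 1) ψ := convexOn_of_tendsto hΨ hlim
  have hψ0 : ψ 0 = 0 := by
    have := hlim 0 (by simp)
    simp only [h0] at this
    exact tendsto_nhds_unique this tendsto_const_nhds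
  refine tendsto_order.2 ⟨fun a ha => ?_, fun b hb => ?_⟩
  · obtain ⟨⟨u, hu⟩, hau⟩ := exists_lt_of_lt_ciSup ha
    filter_upwards [((hlim u hu).const_sub (inner ℝ x u)).eventually (lt_mem_nhds hau)] with m hm
    exact hm.trans_le (inner_sub_le_conjugate (hΨ m) hu)
  · by_contra hcon
    obtain ⟨b', hb1, hb2⟩ := exists_between hb
    have hφ0 := conjugate_nonneg hψ hψ0 x
    have hb'0 : 0 < b' := hφ0.trans_lt hb1
    -- With `φ x < r * b'`, near-maximizers shrunk by the factor `r` still beat `φ x` in the limit.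
    obtain ⟨r, hr, hr1⟩ := exists_between ((div_lt_one hb'0).2 hb1)
    rw [div_lt_iff₀ hb'0] at hr
    have hr0 : 0 ≤ r := by
      by_contra! hneg
      nlinarith
    obtain ⟨k, hk, hkb⟩ := extraction_of_frequently_atTop (not_eventually.1 hcon)
    have hex : ∀ n, ∃ u, ‖u‖ ≤ r ∧ r * b' ≤ inner ℝ x u - Ψ (k n) u := by
      intro n
      obtain ⟨⟨u, hu⟩, hub⟩ := exists_lt_of_lt_ciSup (hb2.trans_le (not_lt.1 (hkb n)))
      refine ⟨r • u, ?_, ?_⟩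
      · rw [norm_smul, Real.norm_of_nonneg hr0]
        exact mul_le_of_le_one_right hr0 (mem_ball_zero_iff.1 hu).le
      · have h1 := (hΨ (k n)).2 hu (y := 0) (by simp) hr0 (sub_nonneg.2 hr1.le) (by ring)
        rw [h0, smul_zero, smul_zero, add_zero, add_zero, smul_eq_mul] at h1
        rw [inner_smul_right]
        nlinarith
    choose w hwr hwb using hex
    obtain ⟨v, hv, j, hj, hjv⟩ := (isCompact_closedBall (0 : EuclideanSpace ℝ (Fin d))
      r).tendsto_subseq (x := w) fun n => by simpa using hwr n
    have hvB : v ∈ Metric.ball (0 : EuclideanSpace ℝ (Fin d)) 1 :=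
      Metric.closedBall_subset_ball hr1 hv
    have hkj := hk.tendsto_atTop.comp hj.tendsto_atTop
    have h1 := (h.comp hkj).tendsto_apply (fun n => hΨ _) (fun u hu => (hlim u hu).comp hkj)
      hvB hjv
    have h2 : r * b' ≤ inner ℝ x v - ψ v :=
      ge_of_tendsto' ((tendsto_const_nhds.inner hjv).sub h1) fun n => hwb (j n)
    linarith [inner_sub_le_conjugate (x := x) hψ hvB]

variable {Fm : ℕ → EuclideanSpace ℝ (Fin d) → EuclideanSpace ℝ (Fin d)}
  {F : EuclideanSpace ℝ (Fin d) → EuclideanSpace ℝ (Fin d)}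

/-- Continuous convergence of `Fm m` to `F`, that is, convergence along moving points. -/
theorem tendsto_subdifferential_conjugate
    (hΨ : ∀ m, ConvexOn ℝ (Metric.ball 0 1) (Ψ m))
    (hlim : ∀ x, Tendsto (fun m => conjugate (Ψ m) x) atTop (𝓝 (conjugate ψ x)))
    (hFm : ∀ m x, Fm m x ∈ subdifferential (conjugate (Ψ m)) x)
    (hF : ∀ x, subdifferential (conjugate ψ) x = {F x}) (x : EuclideanSpace ℝ (Fin d)) :
    Tendsto (fun a : ℕ × EuclideanSpace ℝ (Fin d) => Fm a.1 a.2) (atTop ×ˢ 𝓝 x) (𝓝 (F x)) := by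
  refine tendsto_of_subseq_tendsto fun ns hns => ?_
  obtain ⟨hn1, hn2⟩ := tendsto_prod_iff'.1 hns
  obtain ⟨y, -, k, hk, hky⟩ := tendsto_subseq_of_bounded
    (Metric.isBounded_closedBall (x := (0 : EuclideanSpace ℝ (Fin d))) (r := 1))
    (x := fun n => Fm (ns n).1 (ns n).2)
    (fun n => by simpa using norm_le_one_of_mem_subdifferential (hΨ _) (hFm _ _))
  have hk1 : Tendsto (fun n => (ns (k n)).1) atTop atTop := hn1.comp hk.tendsto_atTop
  have hk2 : Tendsto (fun n => (ns (k n)).2) atTop (𝓝 x) := hn2.comp hk.tendsto_atTop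
  have hval : Tendsto (fun n => conjugate (Ψ (ns (k n)).1) (ns (k n)).2) atTop
      (𝓝 (conjugate ψ x)) := by
    have hdiff : Tendsto (fun n => conjugate (Ψ (ns (k n)).1) (ns (k n)).2
        - conjugate (Ψ (ns (k n)).1) x) atTop (𝓝 0) := by
      refine squeeze_zero_norm (fun n => ?_) (tendsto_iff_norm_sub_tendsto_zero.1 hk2)
      refine abs_le.2 ⟨?_, conjugate_sub_le (hΨ _) _ _⟩
      have := conjugate_sub_le (hΨ (ns (k n)).1) x (ns (k n)).2
      rw [norm_sub_rev] at this
      linarith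
    simpa using hdiff.add ((hlim x).comp hk1)
  have hy : y ∈ subdifferential (conjugate ψ) x := fun z =>
    le_of_tendsto_of_tendsto' (hval.add (hky.inner (tendsto_const_nhds.sub hk2)))
      ((hlim z).comp hk1) fun n => hFm _ _ z
  rw [hF] at hy
  have hy : y = F x := hy
  exact ⟨k, hy ▸ hky⟩

/-- Far from the origin all the maps `Fm m` are close to `x ↦ x / ‖x‖`. -/
theorem LocallyBoundedSubgradients.eventually_norm_sub_direction_le
    (h : LocallyBoundedSubgradients Ψ)
    (hΨ : ∀ m, ConvexOn ℝ (Metric.ball 0 1) (Ψ m)) (h0 : ∀ m, Ψ m 0 = 0)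
    (hlim : Tendsto (fun m => conjugate (Ψ m) 0) atTop (𝓝 (conjugate ψ 0)))
    (hFm : ∀ m x, Fm m x ∈ subdifferential (conjugate (Ψ m)) x) {δ : ℝ} (hδ : 0 < δ) :
    ∃ R, ∀ᶠ m in atTop, ∀ x, R ≤ ‖x‖ → ‖Fm m x - ‖x‖⁻¹ • x‖ ≤ δ := by
  obtain ⟨r, hr, hr1⟩ : ∃ r, max 0 (1 - δ ^ 2 / 4) < r ∧ r < 1 :=
    exists_between (max_lt one_pos (by linarith [pow_pos hδ 2]))
  obtain ⟨hr0, hrδ⟩ := max_lt_iff.1 hr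
  obtain ⟨C, hC0, hC⟩ := h.eventually_abs_le hΨ h0 hr1
  set D := C + (conjugate ψ 0 + 1) with hD
  refine ⟨max 1 (4 * D / δ ^ 2), ?_⟩
  filter_upwards [hC, hlim.eventually (gt_mem_nhds (lt_add_one _))] with m hm hm0 x hx
  obtain ⟨hx1, hx2⟩ := max_le_iff.1 hx
  have hxn : 0 < ‖x‖ := by linarith
  rw [div_le_iff₀ (pow_pos hδ 2)] at hx2
  have h1 := norm_sub_direction_sq_le hr0.le hr1 (hΨ m) (fun u hu => (le_abs_self _).trans (hm u hu))
    (norm_pos_iff.1 hxn) (hFm m x)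
  have h2 : 2 * (C + conjugate (Ψ m) 0) / ‖x‖ ≤ δ ^ 2 / 2 := by
    rw [div_le_iff₀ hxn]
    nlinarith
  exact le_of_sq_le_sq (by linarith) hδ.le

end Convergence

end CenterOutward

theorem theorem3p2 (d : ℕ) (hd : 1 ≤ d)
    (μ : ℕ → ProbabilityMeasure (EuclideanSpace ℝ (Fin d)))
    (P : ProbabilityMeasure (EuclideanSpace ℝ (Fin d)))
    (Fm : ℕ → EuclideanSpace ℝ (Fin d) → EuclideanSpace ℝ (Fin d))
    (F : EuclideanSpace ℝ (Fin d) → EuclideanSpace ℝ (Fin d))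
    (hFm : ∀ m, CenterOutward.IsContinuousDistributionFunction
      (μ m : Measure (EuclideanSpace ℝ (Fin d))) (Fm m))
    (hF : CenterOutward.IsContinuousDistributionFunction
      (P : Measure (EuclideanSpace ℝ (Fin d))) F)
    (hμ : Tendsto μ atTop (𝓝 P)) :
    Tendsto (fun m => ⨆ x, ‖Fm m x - F x‖ₑ) atTop (𝓝 0) := by
  choose Ψ hΨ hΨF using fun m => (hFm m).1
  obtain ⟨⟨ψ, hψ, hψF⟩, hFc⟩ := hF
  have hmem : ∀ m x, Fm m x ∈ CenterOutward.subdifferential (CenterOutward.conjugate (Ψ m)) x :=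
    fun m x => by rw [hΨF m]; rfl
  have hconv := fun m => (hΨ m).convexOn
  have hzero := fun m => (hΨ m).map_zero
  have hb := CenterOutward.locallyBoundedSubgradients_of_tendsto hd hΨ hμ
  have hlim := hb.tendsto_conjugate hconv hzero fun u hu =>
    CenterOutward.IsQuantilePotential.tendsto_of_tendsto hd hΨ hμ hψ hψF hFc.measurable hu
  have hloc := CenterOutward.tendsto_subdifferential_conjugate hconv hlim hmem hψF
  refine ENNReal.tendsto_nhds_zero.2 fun ε hε => ?_
  suffices hδ : ∀ δ : ℝ, 0 < δ → ∀ᶠ m in atTop, ∀ x, ‖Fm m x - F x‖ ≤ δ by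
    obtain ⟨δ, hδ0, hδε⟩ : ∃ δ : ℝ, 0 < δ ∧ ENNReal.ofReal δ ≤ ε := by
      obtain ⟨c, hc0, hcε⟩ := ENNReal.lt_iff_exists_nnreal_btwn.1 hε
      exact ⟨c, by exact_mod_cast hc0, by simpa using hcε.le⟩
    filter_upwards [hδ δ hδ0] with m hm
    refine iSup_le fun x => le_trans ?_ hδε
    rw [← ofReal_norm]
    exact ENNReal.ofReal_le_ofReal (hm x)
  intro δ hδ
  obtain ⟨R, hR⟩ := hb.eventually_norm_sub_direction_le hconv hzero (hlim 0) hmem (half_pos hδ)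
  -- The bound at infinity passes to the pointwise limit `F`.
  have hRF : ∀ x, R ≤ ‖x‖ → ‖F x - ‖x‖⁻¹ • x‖ ≤ δ / 2 := fun x hx =>
    le_of_tendsto (((hloc x).comp (tendsto_id.prodMk tendsto_const_nhds)).sub_const _).norm
      (hR.mono fun m hm => hm x hx)
  have hunif : TendstoUniformlyOn Fm F atTop (Metric.closedBall 0 R) := by
    refine (tendstoLocallyUniformlyOn_iff_tendstoUniformlyOn_of_compact
      (isCompact_closedBall 0 R)).1 (TendstoLocallyUniformly.tendstoLocallyUniformlyOn ?_)
    refine tendstoLocallyUniformly_iff_forall_tendsto.2 fun x => ?_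
    exact (((hFc.tendsto x).comp tendsto_snd).prodMk_nhds (hloc x)).mono_right
      (nhds_le_uniformity (F x))
  filter_upwards [hR, Metric.tendstoUniformlyOn_iff.1 hunif δ hδ] with m hm1 hm2 x
  rcases le_total R ‖x‖ with hx | hx
  · have h1 := hm1 x hx
    have h2 := hRF x hx
    calc ‖Fm m x - F x‖ = ‖(Fm m x - ‖x‖⁻¹ • x) - (F x - ‖x‖⁻¹ • x)‖ := by congr 1; abel
      _ ≤ ‖Fm m x - ‖x‖⁻¹ • x‖ + ‖F x - ‖x‖⁻¹ • x‖ := norm_sub_le _ _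
      _ ≤ δ := by linarith
  · have := hm2 x (by simpa using hx)
    rw [dist_comm, dist_eq_norm] at this
    exact this.le
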